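/- For a finite group $G$, an \emph{integer group determinant} for $G$ is an integer of the form $D\left(\sum_{g\in G}a_g g\right)=\det\left(a_{gh^{-1}}\right)_{g,h\in G}$, where $\sum_{g\in G} a_g g$ is an element of the group ring $\mathbb{Z}[G]$. Let $G=GA(1,5)=\langle X,Y \mid X^5=Y^4=1,\ YXY^{-1}=X^2\rangle$ (SmallGroup(20,3)). **Theorem.** The integer group determinants for $GA(1,5)$ are exactly the integers of the form $$m(m+5\ell)^4,\qquad m,\ell\in\mathbb{Z},\quad m \text{ odd or } 2^4\mid m.$$ That is (with $m,k$ running through all integers subject to the stated congruences, and all signs chosen independently): 1. The values coprime to $10$ are all the integers $\equiv \pm1 \bmod 10$, together with those integers $\equiv\pm3\bmod 10$ that are of the form $(\pm3+10m)(3+10k)^4$. 2. The odd multiples of $5$ are all the odd multiples of $5^5$. 3. The multiples of $10$ are all the multiples of $2^4\cdot5^5$. 4. The even values coprime to $5$ are all the integers $2^4m$ with $m\equiv\pm1\bmod 5$, together with those integers $2^4n$, $n\equiv\pm2\bmod5$, that are of one of the following forms: - $2^4m$ with $m\equiv\pm3\bmod{10}$; - $2^5(\pm1+10m)(3+10k)^4$;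 - $2^6(\pm3+10m)(3+10k)^4$; - $2^7(\pm1+10m)(3+10k)^4$; - $2^8m$ with $m\equiv\pm2\bmod 5$. -/

import Mathlib

/-- The group determinant `D(∑ a_g g) = det (a_{g h⁻¹})` of an element of the integral group ring
`ℤ[G]`, where `g ∈ G` indexes the rows and `h ∈ G` the columns. -/
def groupDet (G : Type*) [Group G] [Fintype G] [DecidableEq G] (a : MonoidAlgebra ℤ G) : ℤ :=
  Matrix.det (Matrix.of fun g h : G => a.coeff (g * h⁻¹))

/-- The set of integer group determinants of a finite group `G`. -/
def integerGroupDets (G : Type*) [Group G] [Fintype G] [DecidableEq G] : Set ℤ :=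
  Set.range (groupDet G)

namespace GA15

/-- The relators of `⟨X, Y | X⁵ = Y⁴ = 1, Y X Y⁻¹ = X²⟩`, with `X = of 0`, `Y = of 1`. -/
def relators : Set (FreeGroup (Fin 2)) :=
  {FreeGroup.of 0 ^ 5, FreeGroup.of 1 ^ 4,
    FreeGroup.of 1 * FreeGroup.of 0 * (FreeGroup.of 1)⁻¹ * (FreeGroup.of 0 ^ 2)⁻¹}

end GA15

/-- The group `GA(1,5) = ⟨X, Y | X⁵ = Y⁴ = 1, Y X Y⁻¹ = X²⟩`, that is SmallGroup(20,3). -/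
abbrev GA15 : Type := PresentedGroup GA15.relators

namespace GA15

/-- The generator `X`. -/
def X : GA15 := PresentedGroup.of 0

/-- The generator `Y`. -/
def Y : GA15 := PresentedGroup.of 1

theorem X_pow : X ^ 5 = 1 := by
  exact PresentedGroup.one_of_mem (rels := relators) (x := FreeGroup.of 0 ^ 5)
    (by simp [relators])

theorem Y_pow : Y ^ 4 = 1 := by
  exact PresentedGroup.one_of_mem (rels := relators) (x := FreeGroup.of 1 ^ 4)
    (by simp [relators])

theorem Y_mul_X : Y * X = X ^ 2 * Y := by
  have h := PresentedGroup.one_of_mem (rels := relators)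
    (x := FreeGroup.of 1 * FreeGroup.of 0 * (FreeGroup.of 1)⁻¹ * (FreeGroup.of 0 ^ 2)⁻¹)
    (by simp [relators])
  have h' : Y * X * Y⁻¹ * (X ^ 2)⁻¹ = 1 := h
  rw [mul_inv_eq_one, mul_inv_eq_iff_eq_mul] at h'
  exact h'

theorem Y_pow_mul_X_pow (j i : ℕ) : Y ^ j * X ^ i = X ^ (2 ^ j * i) * Y ^ j := by
  have h1 : ∀ i : ℕ, Y * X ^ i = X ^ (2 * i) * Y := by
    intro i
    induction i with
    | zero => simp
    | succ i ih =>
      rw [pow_succ, ← mul_assoc, ih, mul_assoc, Y_mul_X, ← mul_assoc, ← pow_add]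
      ring_nf
  induction j with
  | zero => simp
  | succ j ih =>
    rw [pow_succ', mul_assoc, ih, ← mul_assoc, h1, mul_assoc]
    ring_nf

/-- The permutation `t ↦ t + 1` of `ℤ/5`. -/
def permX : Equiv.Perm (ZMod 5) := Equiv.addRight 1

/-- The permutation `t ↦ 2t` of `ℤ/5`. -/
def permY : Equiv.Perm (ZMod 5) := ⟨fun t => 2 * t, fun t => 3 * t, by decide, by decide⟩

/-- The action of `GA(1,5)` on the affine line over `ℤ/5`. -/
def toPerm : GA15 →* Equiv.Perm (ZMod 5) :=
  PresentedGroup.toGroup (f := ![permX, permY]) (rels := relators) (by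
    intro r hr
    rcases hr with rfl | rfl | rfl <;> simp <;> decide)

theorem toPerm_apply (i j : ℕ) (t : ZMod 5) : toPerm (X ^ i * Y ^ j) t = 2 ^ j * t + i := by
  have hX : toPerm X = permX := by simp [toPerm, X]
  have hY : toPerm Y = permY := by simp [toPerm, Y]
  have h1 : ∀ (i : ℕ) (t : ZMod 5), (permX ^ i) t = t + i := by
    intro i
    induction i with
    | zero => simp
    | succ i ih =>
      intro t
      rw [pow_succ', Equiv.Perm.mul_apply, ih]
      simp [permX, add_assoc]
  have h2 : ∀ (j : ℕ) (t : ZMod 5), (permY ^ j) t = 2 ^ j * t := by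
    intro j
    induction j with
    | zero => simp
    | succ i ih =>
      intro t
      rw [pow_succ', Equiv.Perm.mul_apply, ih]
      simp [permY, pow_succ', mul_assoc]
  rw [map_mul, map_pow, map_pow, hX, hY, Equiv.Perm.mul_apply, h1, h2]

theorem exists_normalForm (g : GA15) : ∃ i j : ℕ, g = X ^ i * Y ^ j := by
  have hg : g ∈ Subgroup.closure (Set.range (PresentedGroup.of (rels := relators))) := by
    simp
  induction hg using Subgroup.closure_induction with
  | mem x hx =>
    obtain ⟨k, rfl⟩ := hx
    fin_cases k
    · exact ⟨1, 0, by simp [X]⟩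
    · exact ⟨0, 1, by simp [Y]⟩
  | one => exact ⟨0, 0, by simp⟩
  | mul x y _ _ hx hy =>
    obtain ⟨i, j, rfl⟩ := hx
    obtain ⟨k, l, rfl⟩ := hy
    refine ⟨i + 2 ^ j * k, j + l, ?_⟩
    rw [mul_assoc, ← mul_assoc (Y ^ j), Y_pow_mul_X_pow, pow_add, pow_add]
    simp only [mul_assoc]
  | inv x _ hx =>
    obtain ⟨i, j, rfl⟩ := hx
    refine ⟨2 ^ (3 * j) * (4 * i), 3 * j, ?_⟩
    rw [← Y_pow_mul_X_pow, mul_inv_rev]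
    congr 1
    · rw [inv_eq_iff_mul_eq_one, ← pow_add, show j + 3 * j = 4 * j by ring, pow_mul, Y_pow,
        one_pow]
    · rw [inv_eq_iff_mul_eq_one, ← pow_add, show i + 4 * i = 5 * i by ring, pow_mul, X_pow,
        one_pow]

/-- Every element of `GA(1,5)` is `X^i Y^j` for exactly one pair `0 ≤ i < 5`, `0 ≤ j < 4`. -/
theorem normalForm_bijective :
    Function.Bijective (fun p : Fin 5 × Fin 4 => X ^ (p.1 : ℕ) * Y ^ (p.2 : ℕ)) := by
  constructor
  · intro p q h
    have h0 := congrArg (fun g => toPerm g 0) h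
    have h1 := congrArg (fun g => toPerm g 1) h
    simp only [toPerm_apply] at h0 h1
    clear h
    revert p q
    decide
  · intro g
    obtain ⟨i, j, rfl⟩ := exists_normalForm g
    refine ⟨(⟨i % 5, Nat.mod_lt _ (by norm_num)⟩, ⟨j % 4, Nat.mod_lt _ (by norm_num)⟩), ?_⟩
    simp only
    rw [← pow_eq_pow_mod i X_pow, ← pow_eq_pow_mod j Y_pow]

/-- The normal form `X^i Y^j` as a bijection from `Fin 5 × Fin 4`. -/
noncomputable def normalForm : Fin 5 × Fin 4 ≃ GA15 := Equiv.ofBijective _ normalForm_bijective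

noncomputable instance : Fintype GA15 := Fintype.ofEquiv _ normalForm

noncomputable instance : DecidableEq GA15 := normalForm.symm.decidableEq

end GA15

namespace GA15

open Matrix

/-! Rationally, the group algebra is `ℚ[C₄] × M₄(ℚ)`, through `sigma` and the action `rho` on
`ℤ[ζ₅]`. The block `M₄` acts on itself as four copies of `rho`, so a group determinant is `m * n ^
4` with `m = det sigma` and `n = det rho` (`groupDet_eq`). Two constraints hold. As a circulant
determinant of size four, `m` is odd or divisible by 16 (`odd_or_dvd_cyclicDet`). Modulo 5, the
filtration of `ℤ[ζ₅]` by powers of `ζ₅ - 1` makes `rho` triangular with the four characters of `C₄`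
on the diagonal, so `n ≡ m` (`det_rho_modEq_det_sigma`). No other constraint exists: three explicit
elements, shifted by `entriesNorm` and `entriesKer`, realise every such pair
(`integerGroupDets_eq`). The four lists are then elementary arithmetic of `m * n ^ 4`. -/

/-! ### Arithmetic of the values `m (m + 5 l) ^ 4` -/

theorem int_pow_four_modEq_one {n : ℤ} (h : ¬ 5 ∣ n) : n ^ 4 ≡ 1 [ZMOD 5] := by
  have : n % 5 = 1 ∨ n % 5 = 2 ∨ n % 5 = 3 ∨ n % 5 = 4 := by lia
  rcases this with h | h | h | h <;> simp [Int.ModEq, pow_succ, Int.mul_emod, h]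

theorem exists_pow_four_eq {n : ℤ} (h : n % 10 = 3 ∨ n % 10 = 7) :
    ∃ k : ℤ, n ^ 4 = (3 + 10 * k) ^ 4 := by
  rcases h with h | h
  · exact ⟨n / 10, by congr 1; lia⟩
  -- The fourth power ignores the sign, and `-n ≡ 3` modulo 10.
  · refine ⟨-n / 10, ?_⟩
    rw [← Even.neg_pow (by decide : Even 4) n]
    congr 1; lia

theorem exists_eq_one_add {t : ℤ} (h : t % 10 = 1 ∨ t % 10 = 9) :
    ∃ a : ℤ, t = 1 + 10 * a ∨ t = -1 + 10 * a :=
  ⟨(t + 1) / 10, by lia⟩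

theorem exists_eq_three_add {t : ℤ} (h : t % 10 = 3 ∨ t % 10 = 7) :
    ∃ a : ℤ, t = 3 + 10 * a ∨ t = -3 + 10 * a :=
  ⟨(t + 3) / 10, by lia⟩

/-- The integers `m (m + 5 l) ^ 4` with `m` odd or divisible by `16`. -/
def detValues : Set ℤ := {d : ℤ | ∃ m l : ℤ, (Odd m ∨ 16 ∣ m) ∧ d = m * (m + 5 * l) ^ 4}

theorem mem_detValues {d : ℤ} : d ∈ detValues ↔
    ∃ m n : ℤ, (Odd m ∨ 16 ∣ m) ∧ n % 5 = m % 5 ∧ d = m * n ^ 4 := by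
  constructor
  · rintro ⟨m, l, h, rfl⟩
    exact ⟨m, m + 5 * l, h, by lia, rfl⟩
  · rintro ⟨m, n, h, hn, rfl⟩
    exact ⟨m, (n - m) / 5, h, by congr 2; lia⟩

theorem isCoprime_five {d : ℤ} : IsCoprime d 5 ↔ ¬ 5 ∣ d := by
  exact isCoprime_comm.trans (Nat.prime_iff_prime_int.1 Nat.prime_five).coprime_iff_not_dvd

theorem isCoprime_ten {d : ℤ} : IsCoprime d 10 ↔ Odd d ∧ ¬ 5 ∣ d := by
  rw [show (10 : ℤ) = 2 * 5 by norm_num, IsCoprime.mul_right_iff, isCoprime_five,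
    Int.isCoprime_two_right]

theorem mul_pow_four_emod_five {m n : ℤ} (h : n % 5 = m % 5) : (m * n ^ 4) % 5 = m % 5 := by
  by_cases hn : 5 ∣ n
  · have : 5 ∣ m * n ^ 4 := (hn.pow (by norm_num)).mul_left m
    lia
  · have := (int_pow_four_modEq_one hn).mul_left m
    rwa [mul_one] at this

theorem detValues_coprime_ten : {d : ℤ | d ∈ detValues ∧ IsCoprime d 10} =
      {d : ℤ | d ≡ 1 [ZMOD 10] ∨ d ≡ -1 [ZMOD 10]} ∪
      {d : ℤ | (d ≡ 3 [ZMOD 10] ∨ d ≡ -3 [ZMOD 10]) ∧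
        ∃ m k : ℤ, d = (3 + 10 * m) * (3 + 10 * k) ^ 4 ∨
          d = (-3 + 10 * m) * (3 + 10 * k) ^ 4} := by
  ext d
  simp only [Set.mem_ofPred_eq, Set.mem_union, mem_detValues, isCoprime_ten, Int.ModEq]
  constructor
  · rintro ⟨⟨m, n, -, hnm, rfl⟩, hodd, h5⟩
    have hmod := mul_pow_four_emod_five hnm
    have hm : m % 2 = 1 := Int.odd_iff.1 (Int.odd_mul.1 hodd).1
    have hn : n % 2 = 1 := Int.odd_iff.1 ((Int.odd_pow' (by norm_num)).1 (Int.odd_mul.1 hodd).2)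
    have hd := Int.odd_iff.1 hodd
    by_cases h1 : m % 10 = 1 ∨ m % 10 = 9
    · left; lia
    · right
      obtain ⟨k, hk⟩ := exists_pow_four_eq (n := n) (by lia)
      obtain ⟨a, ha⟩ := exists_eq_three_add (t := m) (by lia)
      refine ⟨by lia, a, k, ?_⟩
      rw [hk]
      exact ha.imp (fun h => by rw [h]) fun h => by rw [h]
  · rintro (h | ⟨h, m, k, h2⟩)
    · refine ⟨?_, Int.odd_iff.2 (by lia), by lia⟩
      rcases h with h | h
      · exact ⟨d, 1, Or.inl (Int.odd_iff.2 (by lia)), by lia, by ring⟩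
      · exact ⟨d, -1, Or.inl (Int.odd_iff.2 (by lia)), by lia, by ring⟩
    · refine ⟨?_, Int.odd_iff.2 (by lia), by lia⟩
      rcases h2 with h2 | h2
      · exact ⟨3 + 10 * m, 3 + 10 * k, Or.inl (Int.odd_iff.2 (by lia)), by lia, h2⟩
      · exact ⟨-3 + 10 * m, -(3 + 10 * k), Or.inl (Int.odd_iff.2 (by lia)), by lia,
          by rw [h2]; ring⟩

/-- Since `d ≡ m ≡ n` modulo 5, the prime 5 divides both `m` and `n`, which gives five factors of 5.
-/
theorem detValues_five_dvd {d : ℤ} (hd : d ∈ detValues) (h5 : 5 ∣ d) :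
    ∃ m n : ℤ, (Odd m ∨ 16 ∣ m) ∧ d = 5 ^ 5 * (m * n ^ 4) := by
  obtain ⟨m, n, h, hnm, rfl⟩ := mem_detValues.1 hd
  have hmod := mul_pow_four_emod_five hnm
  obtain ⟨m, rfl⟩ : 5 ∣ m := by lia
  obtain ⟨n, rfl⟩ : 5 ∣ n := by lia
  refine ⟨m, n, ?_, by ring⟩
  rw [Int.odd_iff] at *
  lia

theorem sixteen_dvd_of_even {m n : ℤ} (h : Odd m ∨ 16 ∣ m) (he : Even (m * n ^ 4)) :
    16 ∣ m * n ^ 4 := by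
  rcases h with h | h
  · have hn : Even n := by
      rw [Int.even_mul, Int.even_pow' (by norm_num)] at he
      exact he.resolve_left (Int.not_even_iff_odd.2 h)
    exact (pow_dvd_pow_of_dvd hn.two_dvd 4).mul_left m
  · exact h.mul_right _

theorem detValues_odd_five : {d : ℤ | d ∈ detValues ∧ Odd d ∧ 5 ∣ d} =
      {d : ℤ | ∃ t : ℤ, Odd t ∧ d = 5 ^ 5 * t} := by
  ext d
  constructor
  · rintro ⟨hd, ho, h5⟩
    obtain ⟨m, n, -, rfl⟩ := detValues_five_dvd hd h5
    exact ⟨m * n ^ 4, (Int.odd_mul.1 ho).2, rfl⟩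
  · rintro ⟨t, ht, rfl⟩
    refine ⟨mem_detValues.2 ⟨5 * t, 5, Or.inl (Odd.mul (by decide) ht), by lia, by ring⟩,
      Odd.mul (by decide) ht, by lia⟩

theorem detValues_ten : {d : ℤ | d ∈ detValues ∧ 10 ∣ d} = {d : ℤ | 2 ^ 4 * 5 ^ 5 ∣ d} := by
  ext d
  constructor
  · rintro ⟨hd, h10⟩
    obtain ⟨m, n, h, rfl⟩ := detValues_five_dvd hd (by lia)
    have := sixteen_dvd_of_even h (n := n) (Int.even_iff.2 (by lia))
    rw [Set.mem_ofPred_eq]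
    lia
  · rintro ⟨t, rfl⟩
    exact ⟨mem_detValues.2 ⟨80 * t, 5, Or.inr (by lia), by lia, by ring⟩, by lia⟩

theorem detValues_even : {d : ℤ | d ∈ detValues ∧ Even d ∧ IsCoprime d 5} =
      {d : ℤ | ∃ m : ℤ, (m ≡ 1 [ZMOD 5] ∨ m ≡ -1 [ZMOD 5]) ∧ d = 2 ^ 4 * m} ∪
      {d : ℤ | (∃ n : ℤ, (n ≡ 2 [ZMOD 5] ∨ n ≡ -2 [ZMOD 5]) ∧ d = 2 ^ 4 * n) ∧
        ((∃ m : ℤ, (m ≡ 3 [ZMOD 10] ∨ m ≡ -3 [ZMOD 10]) ∧ d = 2 ^ 4 * m) ∨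
         (∃ m k : ℤ, d = 2 ^ 5 * (1 + 10 * m) * (3 + 10 * k) ^ 4 ∨
            d = 2 ^ 5 * (-1 + 10 * m) * (3 + 10 * k) ^ 4) ∨
         (∃ m k : ℤ, d = 2 ^ 6 * (3 + 10 * m) * (3 + 10 * k) ^ 4 ∨
            d = 2 ^ 6 * (-3 + 10 * m) * (3 + 10 * k) ^ 4) ∨
         (∃ m k : ℤ, d = 2 ^ 7 * (1 + 10 * m) * (3 + 10 * k) ^ 4 ∨
            d = 2 ^ 7 * (-1 + 10 * m) * (3 + 10 * k) ^ 4) ∨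
         (∃ m : ℤ, (m ≡ 2 [ZMOD 5] ∨ m ≡ -2 [ZMOD 5]) ∧ d = 2 ^ 8 * m))} := by
  ext d
  simp only [Set.mem_ofPred_eq, Set.mem_union, isCoprime_five, Int.ModEq]
  constructor
  · rintro ⟨hd, he, h5⟩
    obtain ⟨m, n, h, hnm, rfl⟩ := mem_detValues.1 hd
    have hmod := mul_pow_four_emod_five hnm
    obtain ⟨q, hq⟩ := sixteen_dvd_of_even h he
    by_cases hq1 : q % 5 = 1 ∨ q % 5 = 4
    · exact Or.inl ⟨q, by lia, hq⟩
    · refine Or.inr ⟨⟨q, by lia, hq⟩, ?_⟩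
      by_cases hq2 : q % 2 = 1
      · exact Or.inl ⟨q, by lia, hq⟩
      · by_cases hq3 : 16 ∣ q
        · obtain ⟨t, rfl⟩ := hq3
          exact Or.inr <| Or.inr <| Or.inr <| Or.inr ⟨t, by lia, by rw [hq]; ring⟩
        -- Here `q` is even but not divisible by 16. An even `n` would force `16 ∣ q`, whether `m`
        -- is odd or divisible by 16.
        · have hn : n % 2 = 1 := by
            by_contra hn
            obtain ⟨s, rfl⟩ : 2 ∣ n := by lia
            rcases h with h | ⟨t, rfl⟩
            · have h2 : q = m * s ^ 4 := by linarith
              have hs : Even s := by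
                have hqe : Even (m * s ^ 4) := h2 ▸ Int.even_iff.2 (by lia)
                rw [Int.even_mul, Int.even_pow' (by norm_num)] at hqe
                exact hqe.resolve_left (Int.not_even_iff_odd.2 h)
              exact hq3 (h2 ▸ (pow_dvd_pow_of_dvd hs.two_dvd 4).mul_left m)
            · exact hq3 ⟨t * s ^ 4, by linarith⟩
          have hn4 : Odd (n ^ 4) := (Int.odd_iff.2 hn).pow
          obtain ⟨t, rfl⟩ : 16 ∣ m := h.resolve_left fun hm =>
            Int.not_even_iff_odd.2 (hm.mul hn4) he
          have hqt : q = t * n ^ 4 := by linarith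
          have ht2 : t % 2 = 0 := by
            have hqe : Even (t * n ^ 4) := hqt ▸ Int.even_iff.2 (by lia)
            rw [Int.even_mul] at hqe
            exact Int.even_iff.1 (hqe.resolve_right (Int.not_even_iff_odd.2 hn4))
          have ht16 : ¬ 16 ∣ t := fun h16 => hq3 (hqt ▸ h16.mul_right _)
          obtain ⟨k, hk⟩ := exists_pow_four_eq (n := n) (by lia)
          rw [hk]
          -- As `t ≡ ±2` modulo 5, its odd part is `±1`, `±3`, `±1` modulo 10 when the power of 2 is
          -- 2, 4, 8.
          obtain ⟨r, rfl | rfl | rfl⟩ : ∃ r, t = 2 * (2 * r + 1) ∨ t = 4 * (2 * r + 1) ∨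
              t = 8 * (2 * r + 1) := by
            rcases (by lia : t % 4 = 2 ∨ t % 8 = 4 ∨ t % 16 = 8) with h1 | h1 | h1
            · exact ⟨t / 4, by lia⟩
            · exact ⟨t / 8, by lia⟩
            · exact ⟨t / 16, by lia⟩
          · obtain ⟨a, ha⟩ := exists_eq_one_add (t := 2 * r + 1) (by lia)
            refine Or.inr <| Or.inl ⟨a, k, ?_⟩
            rcases ha with ha | ha
            · left; rw [ha]; ring
            · right; rw [ha]; ring
          · obtain ⟨a, ha⟩ := exists_eq_three_add (t := 2 * r + 1) (by lia)
            refine Or.inr <| Or.inr <| Or.inl ⟨a, k, ?_⟩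
            rcases ha with ha | ha
            · left; rw [ha]; ring
            · right; rw [ha]; ring
          · obtain ⟨a, ha⟩ := exists_eq_one_add (t := 2 * r + 1) (by lia)
            refine Or.inr <| Or.inr <| Or.inr <| Or.inl ⟨a, k, ?_⟩
            rcases ha with ha | ha
            · left; rw [ha]; ring
            · right; rw [ha]; ring
  · rintro (⟨m, hm, rfl⟩ | ⟨⟨q, hq, hd⟩, h⟩)
    · refine ⟨?_, Int.even_iff.2 (by lia), by lia⟩
      rcases hm with hm | hm
      · exact mem_detValues.2 ⟨16 * m, 1, Or.inr (by lia), by lia, by ring⟩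
      · exact mem_detValues.2 ⟨16 * m, -1, Or.inr (by lia), by lia, by ring⟩
    · refine ⟨?_, Int.even_iff.2 (by lia), by lia⟩
      rw [mem_detValues]
      rcases h with ⟨m, hm, rfl⟩ | ⟨m, k, rfl | rfl⟩ | ⟨m, k, rfl | rfl⟩ | ⟨m, k, rfl | rfl⟩ |
        ⟨m, hm, rfl⟩
      -- The factor `2 ^ 4` is the fourth power of `±2`; the sign is the one that matches `m` modulo
      -- 5.
      · rcases (by lia : m % 5 = 2 ∨ m % 5 = 3) with h | h
        · exact ⟨m, 2, Or.inl (Int.odd_iff.2 (by lia)), by lia, by ring⟩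
        · exact ⟨m, -2, Or.inl (Int.odd_iff.2 (by lia)), by lia, by ring⟩
      · exact ⟨2 ^ 5 * (1 + 10 * m), -(3 + 10 * k), Or.inr (by lia), by lia, by ring⟩
      · exact ⟨2 ^ 5 * (-1 + 10 * m), 3 + 10 * k, Or.inr (by lia), by lia, by ring⟩
      · exact ⟨2 ^ 6 * (3 + 10 * m), -(3 + 10 * k), Or.inr (by lia), by lia, by ring⟩
      · exact ⟨2 ^ 6 * (-3 + 10 * m), 3 + 10 * k, Or.inr (by lia), by lia, by ring⟩
      · exact ⟨2 ^ 7 * (1 + 10 * m), 3 + 10 * k, Or.inr (by lia), by lia, by ring⟩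
      · exact ⟨2 ^ 7 * (-1 + 10 * m), -(3 + 10 * k), Or.inr (by lia), by lia, by ring⟩
      · rcases (by lia : m % 5 = 2 ∨ m % 5 = 3) with h | h
        · exact ⟨2 ^ 4 * m, 2, Or.inr (by lia), by lia, by ring⟩
        · exact ⟨2 ^ 4 * m, -2, Or.inr (by lia), by lia, by ring⟩

/-! ### Two integral representations -/

/-- Multiplication by `ζ₅` on `ℤ[ζ₅]` in the basis `(ζ₅ - 1) ^ i`. -/
def matX : Matrix (Fin 4) (Fin 4) ℤ :=
  !![1, 0, 0, -5; 1, 1, 0, -10; 0, 1, 1, -10; 0, 0, 1, -4]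

/-- The automorphism `ζ₅ ↦ ζ₅ ^ 2` of `ℤ[ζ₅]` in the basis `(ζ₅ - 1) ^ i`. -/
def matY : Matrix (Fin 4) (Fin 4) ℤ :=
  !![1, 0, -5, 15; 0, 2, -10, 25; 0, 1, -6, 15; 0, 0, -1, 3]

/-- The cyclic permutation matrix of size four. -/
def matS : Matrix (Fin 4) (Fin 4) ℤ :=
  !![0, 0, 0, 1; 1, 0, 0, 0; 0, 1, 0, 0; 0, 0, 1, 0]

theorem matX_pow : matX ^ 5 = 1 := by decide +kernel
theorem matY_pow : matY ^ 4 = 1 := by decide +kernel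
theorem matS_pow : matS ^ 4 = 1 := by decide +kernel
theorem matY_mul_matX : matY * matX = matX ^ 2 * matY := by decide +kernel

/-- A representation of `GA(1,5)` from matrices that satisfy the relations. -/
def repOfRelations (A B : Matrix (Fin 4) (Fin 4) ℤ) (hA : A ^ 5 = 1) (hB : B ^ 4 = 1)
    (h : B * A = A ^ 2 * B) : GA15 →* Matrix (Fin 4) (Fin 4) ℤ :=
  (Units.coeHom _).comp <|
    PresentedGroup.toGroup (rels := relators)
      (f := ![Units.ofPowEqOne A 5 hA (by norm_num), Units.ofPowEqOne B 4 hB (by norm_num)]) (by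
        intro r hr
        rcases hr with rfl | rfl | rfl
        · simp
        · simp
        · simp only [map_mul, map_inv, map_pow, FreeGroup.lift_apply_of]
          rw [mul_inv_eq_one, mul_inv_eq_iff_eq_mul]
          ext1
          simpa using h)

theorem repOfRelations_apply {A B : Matrix (Fin 4) (Fin 4) ℤ} (hA : A ^ 5 = 1) (hB : B ^ 4 = 1)
    (h : B * A = A ^ 2 * B) (i j : ℕ) :
    repOfRelations A B hA hB h (X ^ i * Y ^ j) = A ^ i * B ^ j := by
  simp [repOfRelations, X, Y]

/-- The action of `GA(1,5)` on `ℤ[ζ₅]`. -/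
def rho : GA15 →* Matrix (Fin 4) (Fin 4) ℤ :=
  repOfRelations matX matY matX_pow matY_pow matY_mul_matX

/-- The regular representation of the quotient `C₄` of `GA(1,5)`. -/
def sigma : GA15 →* Matrix (Fin 4) (Fin 4) ℤ :=
  repOfRelations 1 matS (one_pow _) matS_pow (by simp)

theorem rho_apply (i j : ℕ) : rho (X ^ i * Y ^ j) = matX ^ i * matY ^ j :=
  repOfRelations_apply _ _ _ i j

theorem sigma_apply (i j : ℕ) : sigma (X ^ i * Y ^ j) = matS ^ j := by
  rw [sigma, repOfRelations_apply, one_pow, one_mul]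

theorem normalForm_apply (p : Fin 5 × Fin 4) :
    normalForm p = X ^ (p.1 : ℕ) * Y ^ (p.2 : ℕ) := rfl

theorem normalForm_zero : normalForm (0, 0) = 1 := by simp [normalForm_apply]

theorem card_eq : Fintype.card GA15 = 20 := by
  rw [Fintype.card_congr normalForm.symm]; rfl

/-- This is a quarter of the regular character `4 tr rho + tr sigma`, because `tr sigma` is four
times the corner entry of `sigma`. -/
theorem trace_rho_add_sigma (g : GA15) :
    (rho g).trace + sigma g 0 0 = if g = 1 then 5 else 0 := by
  obtain ⟨p, rfl⟩ := normalForm.surjective g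
  have key : ∀ p : Fin 5 × Fin 4, (matX ^ (p.1 : ℕ) * matY ^ (p.2 : ℕ)).trace +
      (matS ^ (p.2 : ℕ)) 0 0 = if p = (0, 0) then 5 else 0 := by decide +kernel
  have h1 : normalForm p = 1 ↔ p = (0, 0) := by
    rw [← normalForm_zero, normalForm.apply_eq_iff_eq]
  rw [if_congr h1 rfl rfl, normalForm_apply, rho_apply, sigma_apply, key]

/-! ### Factorisation of the group determinant -/

/-- The linear extension of a representation to functions on the group. -/
noncomputable def linExt (τ : GA15 →* Matrix (Fin 4) (Fin 4) ℤ) (f : GA15 → ℤ) : Matrix (Fin 4) (Fin 4) ℤ :=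
  ∑ g, f g • τ g

theorem linExt_mul (τ : GA15 →* Matrix (Fin 4) (Fin 4) ℤ) (f : GA15 → ℤ) (h : GA15) :
    linExt τ f * τ h = ∑ g, f (g * h⁻¹) • τ g := by
  rw [linExt, Finset.sum_mul, ← Equiv.sum_comp (Equiv.mulRight h) fun g => f (g * h⁻¹) • τ g]
  exact Finset.sum_congr rfl fun g _ => by simp [mul_assoc]

/-- The matrix of the map `ℤ[G] → ℤ[C₄] × M₄(ℤ)`. -/
def decomp : Matrix (Fin 4 ⊕ Fin 4 × Fin 4) GA15 ℤ :=
  of (Sum.elim (fun i g => sigma g i 0) (fun p g => rho g p.1 p.2))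

/-- Five times the inverse of `decomp`. -/
def decompInv : Matrix GA15 (Fin 4 ⊕ Fin 4 × Fin 4) ℤ :=
  of fun g => Sum.elim (fun i => sigma g⁻¹ 0 i) (fun p => rho g⁻¹ p.2 p.1)

/-- Fourier inversion: the entry at `(g, h)` is the character sum of `trace_rho_add_sigma` at `g⁻¹ *
h`. -/
theorem decompInv_mul_decomp : decompInv * decomp = (5 : ℤ) • (1 : Matrix GA15 GA15 ℤ) := by
  ext g h
  have := trace_rho_add_sigma (g⁻¹ * h)
  rw [map_mul, map_mul] at this
  simp only [inv_mul_eq_one, Matrix.trace, Matrix.diag, Matrix.mul_apply] at this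
  simp only [Matrix.mul_apply, decompInv, decomp, of_apply, Fintype.sum_sum_type, Sum.elim_inl,
    Sum.elim_inr, Fintype.sum_prod_type, Matrix.smul_apply, Matrix.one_apply, smul_eq_mul,
    mul_ite, mul_one, mul_zero]
  rw [Finset.sum_comm (γ := Fin 4), add_comm]
  exact this

/-- The action of an element of `ℤ[G]` on `ℤ[C₄] × M₄(ℤ)`. -/
noncomputable def blockAction (f : GA15 → ℤ) :
    Matrix (Fin 4 ⊕ Fin 4 × Fin 4) (Fin 4 ⊕ Fin 4 × Fin 4) ℤ :=
  fromBlocks (linExt sigma f) 0 0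
    (kroneckerMap (· * ·) (linExt rho f) (1 : Matrix (Fin 4) (Fin 4) ℤ))

theorem decomp_mul (f : GA15 → ℤ) :
    decomp * of (fun g h : GA15 => f (g * h⁻¹)) =
      blockAction f * decomp := by
  ext i h
  rcases i with i | ⟨i, j⟩
  · have := congrFun (congrFun (linExt_mul sigma f h) i) 0
    rw [Matrix.mul_apply, Matrix.sum_apply] at this
    rw [Matrix.mul_apply, Matrix.mul_apply]
    simp [decomp, blockAction, Matrix.smul_apply, mul_comm] at this ⊢
    exact this.symm
  · have := congrFun (congrFun (linExt_mul rho f h) i) j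
    rw [Matrix.mul_apply, Matrix.sum_apply] at this
    rw [Matrix.mul_apply, Matrix.mul_apply]
    simp [decomp, blockAction, Fintype.sum_prod_type, Matrix.one_apply, Matrix.smul_apply, mul_comm] at this ⊢
    exact this.symm

theorem groupDet_eq (a : MonoidAlgebra ℤ GA15) :
    groupDet GA15 a = (linExt sigma a.coeff).det * (linExt rho a.coeff).det ^ 4 := by
  -- Any bijection turns `decomp` into a square matrix; its determinant cancels from the
  -- intertwining relation.
  obtain ⟨e⟩ : Nonempty (Fin 4 ⊕ Fin 4 × Fin 4 ≃ GA15) :=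
    Fintype.card_eq.1 (by rw [card_eq]; rfl)
  have h1 := decomp_mul a.coeff
  have h2 := decompInv_mul_decomp
  set A := of (fun g h : GA15 => a.coeff (g * h⁻¹))
  set B := blockAction a.coeff with hB
  have hdet : B.det = (linExt sigma a.coeff).det * (linExt rho a.coeff).det ^ 4 := by
    rw [hB, blockAction, det_fromBlocks_zero₂₁, det_kronecker]
    simp
  have h3 : (decomp.submatrix id e).det ≠ 0 := by
    intro h0
    have h4 : ((decompInv * decomp).submatrix e e).det =
        (((5 : ℤ) • (1 : Matrix GA15 GA15 ℤ)).submatrix e e).det := by rw [h2]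
    rw [← submatrix_mul_equiv decompInv decomp e (Equiv.refl _) e, det_mul] at h4
    simp only [Equiv.coe_refl, h0, mul_zero, submatrix_smul, det_smul, Pi.smul_apply,
      submatrix_one_equiv, det_one, mul_one] at h4
    exact pow_ne_zero _ (by norm_num) h4.symm
  have h5 : (decomp * A).submatrix id e = (B * decomp).submatrix id e :=
    congrArg (submatrix · id e) h1
  rw [← submatrix_mul_equiv decomp A id e e,
    ← submatrix_mul_equiv B decomp id (Equiv.refl _) e] at h5
  have h6 := congrArg det h5
  simp only [Equiv.coe_refl, det_mul, submatrix_id_id, det_submatrix_equiv_self] at h6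
  rw [mul_comm] at h6
  rw [← hdet]
  exact mul_right_cancel₀ h3 h6

theorem linExt_eq_sum (τ : GA15 →* Matrix (Fin 4) (Fin 4) ℤ) (f : GA15 → ℤ) :
    linExt τ f = ∑ p, f (normalForm p) • τ (normalForm p) :=
  (Equiv.sum_comp normalForm fun g => f g • τ g).symm

/-! ### Constraints on the two determinants -/

/-- The coefficients of the image of `f` in `ℤ[C₄]`. -/
noncomputable def cyclicCoeff (f : GA15 → ℤ) (j : Fin 4) : ℤ := ∑ i : Fin 5, f (normalForm (i, j))

theorem linExt_sigma (f : GA15 → ℤ) :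
    linExt sigma f = ∑ j : Fin 4, cyclicCoeff f j • matS ^ (j : ℕ) := by
  simp_rw [linExt_eq_sum, normalForm_apply, sigma_apply, Fintype.sum_prod_type_right,
    cyclicCoeff, Finset.sum_smul, normalForm_apply]

theorem det_sum_matS (u : Fin 4 → ℤ) :
    (∑ j : Fin 4, u j • matS ^ (j : ℕ)).det =
      ((u 0 + u 2) ^ 2 - (u 1 + u 3) ^ 2) * ((u 0 - u 2) ^ 2 + (u 1 - u 3) ^ 2) := by
  have h : ∑ j : Fin 4, u j • matS ^ (j : ℕ) =
      !![u 0, u 3, u 2, u 1; u 1, u 0, u 3, u 2; u 2, u 1, u 0, u 3; u 3, u 2, u 1, u 0] := by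
    have h2 : matS ^ 2 = !![0, 0, 1, 0; 0, 0, 0, 1; 1, 0, 0, 0; 0, 1, 0, 0] := by decide +kernel
    have h3 : matS ^ 3 = !![0, 1, 0, 0; 0, 0, 1, 0; 0, 0, 0, 1; 1, 0, 0, 0] := by decide +kernel
    have h0 : matS ^ 0 = !![1, 0, 0, 0; 0, 1, 0, 0; 0, 0, 1, 0; 0, 0, 0, 1] := by decide +kernel
    have h1 : matS ^ 1 = !![0, 0, 0, 1; 1, 0, 0, 0; 0, 1, 0, 0; 0, 0, 1, 0] := pow_one _
    rw [Fin.sum_univ_four]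
    simp only [Fin.val_zero, Fin.val_one, Fin.val_two, show ((3 : Fin 4) : ℕ) = 3 from rfl, h0, h1,
      h2, h3]
    ext i j
    fin_cases i <;> fin_cases j <;> simp [Matrix.add_apply, -zsmul_eq_mul]
  rw [h, det_succ_row_zero]
  simp [Fin.sum_univ_succ, det_fin_three, Fin.succAbove]
  ring

/-- A circulant determinant of size four is odd or divisible by `16`. -/
theorem odd_or_dvd_cyclicDet (a b c d : ℤ) :
    Odd (((a + c) ^ 2 - (b + d) ^ 2) * ((a - c) ^ 2 + (b - d) ^ 2)) ∨
      16 ∣ ((a + c) ^ 2 - (b + d) ^ 2) * ((a - c) ^ 2 + (b - d) ^ 2) := by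
  rcases Int.even_or_odd' (a + c) with ⟨p, hp | hp⟩ <;>
    rcases Int.even_or_odd' (b + d) with ⟨q, hq | hq⟩
  · right
    obtain rfl : a = 2 * p - c := by lia
    obtain rfl : b = 2 * q - d := by lia
    exact ⟨(p ^ 2 - q ^ 2) * ((p - c) ^ 2 + (q - d) ^ 2), by ring⟩
  · left
    obtain rfl : a = 2 * p - c := by lia
    obtain rfl : b = 2 * q + 1 - d := by lia
    exact Odd.mul ⟨2 * p ^ 2 - 2 * q ^ 2 - 2 * q - 1, by ring⟩
      ⟨2 * (p - c) ^ 2 + 2 * (q - d) ^ 2 + 2 * (q - d), by ring⟩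
  · left
    obtain rfl : a = 2 * p + 1 - c := by lia
    obtain rfl : b = 2 * q - d := by lia
    exact Odd.mul ⟨2 * p ^ 2 + 2 * p - 2 * q ^ 2, by ring⟩
      ⟨2 * (p - c) ^ 2 + 2 * (p - c) + 2 * (q - d) ^ 2, by ring⟩
  · right
    obtain rfl : a = 2 * p + 1 - c := by lia
    obtain rfl : b = 2 * q + 1 - d := by lia
    obtain ⟨r, hr⟩ := Int.even_mul_succ_self p
    obtain ⟨s, hs⟩ := Int.even_mul_succ_self q
    -- A difference of two odd squares is divisible by 8, and a sum of two odd squares by 2.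
    refine ⟨(r - s) * (2 * ((p - c) ^ 2 + (p - c) + (q - d) ^ 2 + (q - d)) + 1), ?_⟩
    linear_combination 4 * ((2 * p + 1 - 2 * c) ^ 2 + (2 * q + 1 - 2 * d) ^ 2) * (hr - hs)

theorem cast_rho_eq_zero (g : GA15) {a b : Fin 4} (h : a < b) : (rho g a b : ZMod 5) = 0 := by
  obtain ⟨p, rfl⟩ := normalForm.surjective g
  rw [normalForm_apply, rho_apply]
  revert p a b
  decide +kernel

theorem cast_rho_diag (p : Fin 5 × Fin 4) (a : Fin 4) :
    (rho (normalForm p) a a : ZMod 5) = 2 ^ ((p.2 : ℕ) * (a : ℕ)) := by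
  rw [normalForm_apply, rho_apply]
  revert p a
  decide +kernel

theorem cast_det_linExt_rho (f : GA15 → ℤ) :
    ((linExt rho f).det : ZMod 5) =
      ∏ a : Fin 4, ∑ j : Fin 4, (cyclicCoeff f j : ZMod 5) * 2 ^ ((j : ℕ) * (a : ℕ)) := by
  have h1 : ((linExt rho f).det : ZMod 5) =
      ((Int.castRingHom (ZMod 5)).mapMatrix (linExt rho f)).det :=
    RingHom.map_det (Int.castRingHom (ZMod 5)) _
  rw [h1, Matrix.det_of_isLowerTriangular]
  · refine Finset.prod_congr rfl fun a _ => ?_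
    rw [linExt_eq_sum, RingHom.mapMatrix_apply, Matrix.map_apply, Matrix.sum_apply, map_sum,
      Fintype.sum_prod_type_right]
    refine Finset.sum_congr rfl fun j _ => ?_
    simp only [cyclicCoeff, Matrix.smul_apply, smul_eq_mul, map_mul, eq_intCast, cast_rho_diag,
      Int.cast_sum, Finset.sum_mul]
  · intro a b hab
    rw [linExt, RingHom.mapMatrix_apply, Matrix.map_apply, Matrix.sum_apply, map_sum]
    refine Finset.sum_eq_zero fun g _ => ?_
    have hab' : a < b := hab
    simp [Matrix.smul_apply, cast_rho_eq_zero g hab']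

/-- The powers of 2 are the four fourth roots of unity in `𝔽₅`, so the circulant determinant splits
into the same linear factors as `det rho`. -/
theorem det_rho_modEq_det_sigma (f : GA15 → ℤ) :
    (5 : ℤ) ∣ (linExt rho f).det - (linExt sigma f).det := by
  rw [← Nat.cast_ofNat (n := 5), ← ZMod.intCast_zmod_eq_zero_iff_dvd, Int.cast_sub, cast_det_linExt_rho, linExt_sigma,
    det_sum_matS]
  push_cast
  simp [Fin.prod_univ_four, Fin.sum_univ_four]
  generalize (cyclicCoeff f 0 : ZMod 5) = a
  generalize (cyclicCoeff f 1 : ZMod 5) = b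
  generalize (cyclicCoeff f 2 : ZMod 5) = c
  generalize (cyclicCoeff f 3 : ZMod 5) = d
  revert a b c d
  decide +kernel

/-! ### Realisation of all values -/

theorem linExt_add_smul (τ : GA15 →* Matrix (Fin 4) (Fin 4) ℤ) (f g h : GA15 → ℤ) (k l : ℤ) :
    linExt τ (f + k • g + l • h) = linExt τ f + k • linExt τ g + l • linExt τ h := by
  simp only [linExt, Pi.add_apply, Pi.smul_apply, add_smul, smul_eq_mul, mul_smul,
    Finset.sum_add_distrib, Finset.smul_sum]

/-- The function on `GA(1,5)` whose value at `X ^ i * Y ^ j` is the entry `c i j`. -/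
noncomputable def ofEntries (c : Matrix (Fin 5) (Fin 4) ℤ) (g : GA15) : ℤ :=
  c (normalForm.symm g).1 (normalForm.symm g).2

theorem cyclicCoeff_ofEntries (c : Matrix (Fin 5) (Fin 4) ℤ) (j : Fin 4) :
    cyclicCoeff (ofEntries c) j = ∑ i : Fin 5, c i j := by
  simp [cyclicCoeff, ofEntries]

theorem linExt_rho_ofEntries (c : Matrix (Fin 5) (Fin 4) ℤ) :
    linExt rho (ofEntries c) =
      ∑ p : Fin 5 × Fin 4, c p.1 p.2 • (matX ^ (p.1 : ℕ) * matY ^ (p.2 : ℕ)) := by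
  simp_rw [linExt_eq_sum, ofEntries, normalForm.symm_apply_apply, normalForm_apply, rho_apply]

/-- The element with image `1 + Y + Y ^ 2 + Y ^ 3` in `ℤ[C₄]` and `4 E₀₀` under `rho`. -/
def entriesNorm : Matrix (Fin 5) (Fin 4) ℤ :=
  !![1, 1, 1, 1; -3, 1, 1, 1; 1, -3, 1, 1; 1, 1, 1, -3; 1, 1, -3, 1]

/-- The element with image `0` in `ℤ[C₄]` and `5 E₀₀` under `rho`. -/
def entriesKer : Matrix (Fin 5) (Fin 4) ℤ :=
  !![1, 1, 1, 1; -4, 1, 1, 1; 1, -4, 1, 1; 1, 1, 1, -4; 1, 1, -4, 1]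

/-- The identity of `ℤ[G]`. -/
def entriesOne : Matrix (Fin 5) (Fin 4) ℤ :=
  !![1, 0, 0, 0; 0, 0, 0, 0; 0, 0, 0, 0; 0, 0, 0, 0; 0, 0, 0, 0]

/-- An element with image `1 + Y + Y ^ 2` in `ℤ[C₄]`. -/
def entriesThree : Matrix (Fin 5) (Fin 4) ℤ :=
  !![2, 3, -9, 7; 2, -3, 6, -5; -9, 5, -1, 5; 9, -8, -1, 0; -3, 4, 6, -7]

/-- An element with image `1 - Y` in `ℤ[C₄]`. -/
def entriesZero : Matrix (Fin 5) (Fin 4) ℤ :=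
  !![0, -7, 15, -8; -5, 6, -7, 6; 14, -8, 2, -8; -13, 11, 2, 0; 5, -3, -12, 10]

/-- With `N = 1 + Y + Y² + Y³` and `S` the sum over the group, `entriesNorm` is `S - 4 N X` and
`entriesKer` is `S - 5 N X`. Under `rho`, `S` vanishes and `N X` is `v ↦ Tr(ζ₅ v)`, which is `-1` on
`1` and `0` on the other basis vectors. -/
theorem linExt_rho_entriesNorm : linExt rho (ofEntries entriesNorm) =
    !![4, 0, 0, 0; 0, 0, 0, 0; 0, 0, 0, 0; 0, 0, 0, 0] := by
  rw [linExt_rho_ofEntries]; decide +kernel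

theorem linExt_rho_entriesKer : linExt rho (ofEntries entriesKer) =
    !![5, 0, 0, 0; 0, 0, 0, 0; 0, 0, 0, 0; 0, 0, 0, 0] := by
  rw [linExt_rho_ofEntries]; decide +kernel

/-- Determinants of the combinations `f + k * entriesNorm + l * entriesKer`. -/
theorem mem_integerGroupDets_of_entries (c : Matrix (Fin 5) (Fin 4) ℤ) (k l : ℤ)
    {M : Matrix (Fin 4) (Fin 4) ℤ}
    (hM : ∑ p : Fin 5 × Fin 4, c p.1 p.2 • (matX ^ (p.1 : ℕ) * matY ^ (p.2 : ℕ)) = M) :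
    (∑ j : Fin 4, (∑ i : Fin 5, c i j + k) • matS ^ (j : ℕ)).det *
      (M + !![4 * k + 5 * l, 0, 0, 0; 0, 0, 0, 0; 0, 0, 0, 0; 0, 0, 0, 0]).det ^ 4 ∈
      integerGroupDets GA15 := by
  let f : GA15 → ℤ := ofEntries c + k • ofEntries entriesNorm + l • ofEntries entriesKer
  refine ⟨MonoidAlgebra.ofCoeff (Finsupp.equivFunOnFinite.symm f), ?_⟩
  rw [groupDet_eq, MonoidAlgebra.coeff_ofCoeff, Finsupp.coe_equivFunOnFinite_symm]
  congr 2
  · rw [linExt_sigma]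
    refine Finset.sum_congr rfl fun j _ => ?_
    congr 1
    have h1 : ∀ j, ∑ i : Fin 5, entriesNorm i j = 1 := by decide +kernel
    have h2 : ∀ j, ∑ i : Fin 5, entriesKer i j = 0 := by decide +kernel
    have h3 : cyclicCoeff f j = cyclicCoeff (ofEntries c) j +
        k * cyclicCoeff (ofEntries entriesNorm) j + l * cyclicCoeff (ofEntries entriesKer) j := by
      simp [cyclicCoeff, f, Finset.sum_add_distrib, Finset.mul_sum]
    rw [h3, cyclicCoeff_ofEntries, cyclicCoeff_ofEntries, cyclicCoeff_ofEntries, h1, h2]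
    ring
  · congr 1
    rw [linExt_add_smul, linExt_rho_ofEntries c, hM, linExt_rho_entriesNorm, linExt_rho_entriesKer,
      add_assoc]
    congr 1
    ext i j
    fin_cases i <;> fin_cases j <;> simp [-zsmul_eq_mul, mul_comm]

theorem mem_of_emod_four_eq_one (k l : ℤ) :
    (1 + 4 * k) * (1 + 4 * k + 5 * l) ^ 4 ∈ integerGroupDets GA15 := by
  have h := mem_integerGroupDets_of_entries entriesOne k l
    (M := !![1, 0, 0, 0; 0, 1, 0, 0; 0, 0, 1, 0; 0, 0, 0, 1]) (by decide +kernel)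
  convert h using 2
  · rw [det_sum_matS]
    simp [entriesOne, Fin.sum_univ_succ]
    ring
  · simp [det_succ_row_zero, Fin.sum_univ_succ, Fin.succAbove]
    ring

theorem mem_of_emod_four_eq_three (k l : ℤ) :
    (3 + 4 * k) * (3 + 4 * k + 5 * l) ^ 4 ∈ integerGroupDets GA15 := by
  have h := mem_integerGroupDets_of_entries entriesThree k l
    (M := !![3, 0, 0, 0; 0, 2, 0, 5; 0, 0, 1, 0; 0, 1, 0, 3]) (by decide +kernel)
  convert h using 2
  · rw [det_sum_matS]
    simp [entriesThree, Fin.sum_univ_succ]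
    ring
  · simp [det_succ_row_zero, Fin.sum_univ_succ, Fin.succAbove]
    ring

theorem mem_of_sixteen_dvd (k l : ℤ) :
    (16 * k) * (16 * k + 5 * l) ^ 4 ∈ integerGroupDets GA15 := by
  -- The lower block of `M` has determinant `-1`, and `-(4 * k + 5 * (-4 * k - l)) = 16 * k + 5 *
  -- l`.
  have h := mem_integerGroupDets_of_entries entriesZero k (-4 * k - l)
    (M := !![0, 0, 0, 0; 0, -1, 0, 0; 0, 0, 2, 5; 0, 0, -1, -2]) (by decide +kernel)
  convert h using 2
  · rw [det_sum_matS]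
    simp [entriesZero, Fin.sum_univ_succ]
    ring
  · simp [det_succ_row_zero, Fin.sum_univ_succ, Fin.succAbove]
    ring

theorem integerGroupDets_eq : integerGroupDets GA15 = detValues := by
  ext d
  constructor
  · rintro ⟨a, rfl⟩
    obtain ⟨l, hl⟩ := det_rho_modEq_det_sigma a.coeff
    refine ⟨(linExt sigma a.coeff).det, l, ?_, ?_⟩
    · rw [linExt_sigma, det_sum_matS]
      exact odd_or_dvd_cyclicDet _ _ _ _
    · rw [groupDet_eq, ← hl, add_sub_cancel]
  · rintro ⟨m, l, h | ⟨k, rfl⟩, rfl⟩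
    · rcases (by have := Int.odd_iff.1 h; lia : m % 4 = 1 ∨ m % 4 = 3) with h4 | h4
      · obtain ⟨k, rfl⟩ : ∃ k, m = 1 + 4 * k := ⟨m / 4, by lia⟩
        exact mem_of_emod_four_eq_one k l
      · obtain ⟨k, rfl⟩ : ∃ k, m = 3 + 4 * k := ⟨m / 4, by lia⟩
        exact mem_of_emod_four_eq_three k l
    · exact mem_of_sixteen_dvd k l

end GA15

theorem mainTheorem4 :
    -- all integer group determinants of `GA(1,5)`
    integerGroupDets GA15 =
      {d : ℤ | ∃ m l : ℤ, (Odd m ∨ 16 ∣ m) ∧ d = m * (m + 5 * l) ^ 4} ∧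
    -- those coprime to `10`
    {d : ℤ | d ∈ integerGroupDets GA15 ∧ IsCoprime d 10} =
      {d : ℤ | d ≡ 1 [ZMOD 10] ∨ d ≡ -1 [ZMOD 10]} ∪
      {d : ℤ | (d ≡ 3 [ZMOD 10] ∨ d ≡ -3 [ZMOD 10]) ∧
        ∃ m k : ℤ, d = (3 + 10 * m) * (3 + 10 * k) ^ 4 ∨
          d = (-3 + 10 * m) * (3 + 10 * k) ^ 4} ∧
    -- the odd multiples of `5`
    {d : ℤ | d ∈ integerGroupDets GA15 ∧ Odd d ∧ 5 ∣ d} =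
      {d : ℤ | ∃ t : ℤ, Odd t ∧ d = 5 ^ 5 * t} ∧
    -- the multiples of `10`
    {d : ℤ | d ∈ integerGroupDets GA15 ∧ 10 ∣ d} = {d : ℤ | 2 ^ 4 * 5 ^ 5 ∣ d} ∧
    -- the even ones coprime to `5`
    {d : ℤ | d ∈ integerGroupDets GA15 ∧ Even d ∧ IsCoprime d 5} =
      {d : ℤ | ∃ m : ℤ, (m ≡ 1 [ZMOD 5] ∨ m ≡ -1 [ZMOD 5]) ∧ d = 2 ^ 4 * m} ∪
      {d : ℤ | (∃ n : ℤ, (n ≡ 2 [ZMOD 5] ∨ n ≡ -2 [ZMOD 5]) ∧ d = 2 ^ 4 * n) ∧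
        ((∃ m : ℤ, (m ≡ 3 [ZMOD 10] ∨ m ≡ -3 [ZMOD 10]) ∧ d = 2 ^ 4 * m) ∨
         (∃ m k : ℤ, d = 2 ^ 5 * (1 + 10 * m) * (3 + 10 * k) ^ 4 ∨
            d = 2 ^ 5 * (-1 + 10 * m) * (3 + 10 * k) ^ 4) ∨
         (∃ m k : ℤ, d = 2 ^ 6 * (3 + 10 * m) * (3 + 10 * k) ^ 4 ∨
            d = 2 ^ 6 * (-3 + 10 * m) * (3 + 10 * k) ^ 4) ∨
         (∃ m k : ℤ, d = 2 ^ 7 * (1 + 10 * m) * (3 + 10 * k) ^ 4 ∨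
            d = 2 ^ 7 * (-1 + 10 * m) * (3 + 10 * k) ^ 4) ∨
         (∃ m : ℤ, (m ≡ 2 [ZMOD 5] ∨ m ≡ -2 [ZMOD 5]) ∧ d = 2 ^ 8 * m))} := by
  rw [GA15.integerGroupDets_eq]
  exact ⟨rfl, GA15.detValues_coprime_ten, GA15.detValues_odd_five, GA15.detValues_ten,
    GA15.detValues_even⟩
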